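/- Let $C\subset\mathbb{R}^2$ be a convex disc, that is, a compact convex set with nonempty interior. Two sets overlap if their interiors intersect, and they touch if they intersect but do not overlap. A Hadwiger family of $C$ is a collection of translates of $C$ that all touch $C$ and have pairwise disjoint interiors; a strict Hadwiger family of $C$ is a collection of translates of $C$ that all touch $C$ and are pairwise disjoint. The blocking number $B(C)$ is the minimum number of translates in an inclusion-maximal Hadwiger family of $C$, and the strict blocking number $B'(C)$ is the minimum number of translates in an inclusion-maximal strict Hadwiger family of $C$. Then \[ B(C)=4,\qquad B'(C)=\begin{cases}3 & \text{if } C \text{ is not a parallelogram},\\ 2 & \text{if } C \text{ is a parallelogram.}\end{cases} \] Moreover, the bound $B(C)\ge 4$ holds in the following stronger form: if $C_1,\dots,C_m$ are translates of $C$, none of which overlaps $C$ (they need not touch $C$ and may overlap each other), such that every translate of $C$ that touches $C$ overlaps some $C_i$, then $m\ge 4$. -/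

import Mathlib

open scoped Pointwise

/-- A convex disc in the plane: a compact convex set with nonempty interior. -/
structure IsConvexDisc (C : Set (EuclideanSpace ℝ (Fin 2))) : Prop where
  convex : Convex ℝ C
  isCompact : IsCompact C
  interior_nonempty : (interior C).Nonempty

/-- A (solid, nondegenerate) parallelogram in the plane: a translate of
`{s • w 0 + t • w 1 | 0 ≤ s ≤ 1, 0 ≤ t ≤ 1}` with `w 0`, `w 1` linearly independent. -/
def IsParallelogram (C : Set (EuclideanSpace ℝ (Fin 2))) : Prop :=
  ∃ (a : EuclideanSpace ℝ (Fin 2)) (w : Fin 2 → EuclideanSpace ℝ (Fin 2)),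
    LinearIndependent ℝ w ∧ C = a +ᵥ parallelepiped w

/-- Two sets overlap if their interiors have a common point. -/
def Overlap (C D : Set (EuclideanSpace ℝ (Fin 2))) : Prop :=
  (interior C ∩ interior D).Nonempty

/-- Two sets touch if they have a common point but do not overlap. -/
def Touch (C D : Set (EuclideanSpace ℝ (Fin 2))) : Prop :=
  (C ∩ D).Nonempty ∧ ¬ Overlap C D

/-- `V` is the set of translation vectors of a Hadwiger family of `C`: the translates `v +ᵥ C`,
`v ∈ V`, all touch `C` and have pairwise disjoint interiors. (For nonempty bounded `C`, distinct
vectors give distinct translates, so a collection of translates of `C` is the same thing as its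
set of translation vectors.) -/
def IsHadwigerFamily (C V : Set (EuclideanSpace ℝ (Fin 2))) : Prop :=
  (∀ v ∈ V, Touch (v +ᵥ C) C) ∧ V.Pairwise fun v w => ¬ Overlap (v +ᵥ C) (w +ᵥ C)

/-- `V` is the set of translation vectors of a strict Hadwiger family of `C`: the translates
`v +ᵥ C`, `v ∈ V`, all touch `C` and are pairwise disjoint. -/
def IsStrictHadwigerFamily (C V : Set (EuclideanSpace ℝ (Fin 2))) : Prop :=
  (∀ v ∈ V, Touch (v +ᵥ C) C) ∧ V.Pairwise fun v w => Disjoint (v +ᵥ C) (w +ᵥ C)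

/-- The blocking number: the minimum number of translates in a Hadwiger family of `C` that is
maximal with respect to inclusion. (An infimum of a nonempty set in `ℕ∞` is attained, and the
infimum of the empty set is `⊤`.) -/
noncomputable def blockingNumber (C : Set (EuclideanSpace ℝ (Fin 2))) : ℕ∞ :=
  sInf {n | ∃ V, Maximal (IsHadwigerFamily C) V ∧ V.encard = n}

/-- The strict blocking number: the minimum number of translates in a strict Hadwiger family of
`C` that is maximal with respect to inclusion. -/
noncomputable def strictBlockingNumber (C : Set (EuclideanSpace ℝ (Fin 2))) : ℕ∞ :=
  sInf {n | ∃ V, Maximal (IsStrictHadwigerFamily C) V ∧ V.encard = n}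

/-! Only the difference body `C - C` matters: it is the closed unit ball of a norm on the plane
(`IsConvexDisc.exists_norm`). In this norm a translate touches `C` when its vector has norm 1, two
translates overlap when their vectors are at distance less than 1, and they are disjoint when that
distance exceeds 1. Maximality then says that open (in the strict case closed) unit balls around the
chosen unit vectors cover the unit circle. The main tool is that every unit vector is a vertex of an
affine regular hexagon inscribed in the circle.

Lower bound 4 (`four_le_card_of_cover`): an open unit ball whose centre has norm at least 1 contains
at most two of the six vertices. Three such balls can cover a hexagon only by covering each vertex
exactly once. As any point of the circle can serve as a vertex, the balls would cut the connected
circle into disjoint open pieces.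

Upper bound 4 (`exists_cover_four`): take `±p` and `±x`, with `x` the unit vector along the sum of
the vertices `q` and `q - p`. This can fail only if `p` is parallel to a long segment of the circle
or is a corner of a parallelogram ball; `exists_good_direction` avoids both.

Strict case: three alternate vertices of a hexagon work unless the ball is a parallelogram. By
connectedness two closed balls can cover the circle only if the unit ball is a parallelogram, and
then the midpoints of two opposite sides suffice. Finally, `C - C` is a parallelogram exactly when
`C` is. -/

section NormedPlane

variable {F : Type*} [NormedAddCommGroup F]

/-! ### Norm estimates in the sectors of an inscribed hexagon. -/

open Classical in
/-- The indicator of the open unit ball around `v`. -/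
noncomputable def ballIndicator (v x : F) : ℕ := if ‖x - v‖ < 1 then 1 else 0

theorem ballIndicator_le_one (v x : F) : ballIndicator v x ≤ 1 := by
  unfold ballIndicator; split_ifs <;> simp

theorem ballIndicator_eq_zero {v x : F} (h : 1 ≤ ‖x - v‖) : ballIndicator v x = 0 := by
  unfold ballIndicator; rw [if_neg (not_lt.2 h)]

theorem ballIndicator_eq_one {v x : F} (h : ‖x - v‖ < 1) : ballIndicator v x = 1 := by
  unfold ballIndicator; rw [if_pos h]

/-- The six vectors `±p, ±q, ±(q - p)` are the vertices of an affine regular hexagon inscribed in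
the unit sphere. -/
structure UnitHexagon (p q : F) : Prop where
  left : ‖p‖ = 1
  right : ‖q‖ = 1
  sub : ‖q - p‖ = 1

namespace UnitHexagon

variable {p q : F}

theorem symm (h : UnitHexagon p q) : UnitHexagon q p :=
  ⟨h.right, h.left, by rw [norm_sub_rev]; exact h.sub⟩

theorem rotate (h : UnitHexagon p q) : UnitHexagon q (q - p) :=
  ⟨h.right, h.sub, by rw [sub_sub_cancel_left, norm_neg]; exact h.left⟩

theorem neg (h : UnitHexagon p q) : UnitHexagon (-p) (-q) :=
  ⟨by rw [norm_neg]; exact h.left, by rw [norm_neg]; exact h.right,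
    by rw [neg_sub_neg, norm_sub_rev]; exact h.sub⟩

theorem sub_right (h : UnitHexagon p q) : UnitHexagon p (p - q) :=
  h.symm.rotate

theorem rotate_rotate (h : UnitHexagon p q) : UnitHexagon (q - p) (-p) := by
  simpa only [show q - p - q = -p by abel] using h.rotate.rotate

theorem neg_rotate (h : UnitHexagon p q) : UnitHexagon (-q) (p - q) := by
  simpa only [neg_sub] using h.rotate.neg

theorem neg_rotate_rotate (h : UnitHexagon p q) : UnitHexagon (p - q) p := by
  simpa only [neg_sub, neg_neg] using h.rotate_rotate.neg

variable [NormedSpace ℝ F]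

/-- On the line through `q` parallel to `p`, the points `q - p` and `q` both have norm 1, so by
convexity the norm cannot drop below 1 beyond `q`. -/
theorem le_norm (h : UnitHexagon p q) {s t : ℝ} (hs : 0 ≤ s) (ht : 0 ≤ t) :
    t ≤ ‖s • p + t • q‖ := by
  rcases ht.eq_or_lt with rfl | ht
  · exact norm_nonneg _
  have key : ((s + t) * t) • q = t • (s • p + t • q) + (s * t) • (q - p) := by module
  have h1 := norm_add_le (t • (s • p + t • q)) ((s * t) • (q - p))
  rw [← key, norm_smul, norm_smul, norm_smul, h.right, h.sub, Real.norm_of_nonneg (by positivity),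
    Real.norm_of_nonneg (by positivity), Real.norm_of_nonneg (by positivity)] at h1
  nlinarith

theorem le_norm' (h : UnitHexagon p q) {s t : ℝ} (hs : 0 ≤ s) (ht : 0 ≤ t) :
    s ≤ ‖s • p + t • q‖ := by
  rw [add_comm]; exact h.symm.le_norm ht hs

theorem norm_le_add (h : UnitHexagon p q) {s t : ℝ} (hs : 0 ≤ s) (ht : 0 ≤ t) :
    ‖s • p + t • q‖ ≤ s + t := by
  refine (norm_add_le _ _).trans ?_
  rw [norm_smul, norm_smul, h.left, h.right, Real.norm_of_nonneg hs, Real.norm_of_nonneg ht]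
  simp

/-- The norm is convex in the `p`-coordinate and, by `le_norm`, smallest at coordinate 0. -/
theorem norm_mono_left (h : UnitHexagon p q) {s s' t : ℝ} (hs : 0 ≤ s) (hss : s ≤ s')
    (ht : 0 ≤ t) : ‖s • p + t • q‖ ≤ ‖s' • p + t • q‖ := by
  have hs' : 0 ≤ s' := hs.trans hss
  rcases hs'.eq_or_lt with h0 | hs'
  · have : s = 0 := by linarith
    subst this; subst h0; exact le_rfl
  have key : s' • (s • p + t • q) = s • (s' • p + t • q) + (s' - s) • (t • q) := by module
  have h1 := norm_add_le (s • (s' • p + t • q)) ((s' - s) • (t • q))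
  have h2 := h.le_norm hs'.le ht
  rw [← key, norm_smul, norm_smul, norm_smul, norm_smul, h.right,
    Real.norm_of_nonneg (by positivity), Real.norm_of_nonneg (by positivity),
    Real.norm_of_nonneg (by positivity), Real.norm_of_nonneg (by linarith)] at h1
  have h3 : s' * ‖s • p + t • q‖ ≤ s' * ‖s' • p + t • q‖ := by nlinarith
  exact le_of_mul_le_mul_left h3 hs'

theorem norm_mono (h : UnitHexagon p q) {s s' t t' : ℝ} (hs : 0 ≤ s) (hss : s ≤ s')
    (ht : 0 ≤ t) (htt : t ≤ t') : ‖s • p + t • q‖ ≤ ‖s' • p + t' • q‖ := by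
  refine (h.norm_mono_left hs hss ht).trans ?_
  rw [add_comm, add_comm (s' • p)]
  exact h.symm.norm_mono_left ht htt (hs.trans hss)

/-- Rewritten in the sector with edge `p - q` that contains it, the vector has nonnegative
coordinates with sum `max s t`. -/
theorem norm_sub_le_max (h : UnitHexagon p q) {s t : ℝ} (hs : 0 ≤ s) (ht : 0 ≤ t) :
    ‖s • p - t • q‖ ≤ max s t := by
  rcases le_total t s with hts | hts
  · have e : s • p - t • q = (s - t) • p + t • (p - q) := by module
    rw [e]
    refine (h.sub_right.norm_le_add (by linarith) ht).trans ?_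
    simp
  · have e : s • p - t • q = -((t - s) • q + s • (q - p)) := by module
    rw [e, norm_neg]
    refine (h.rotate.norm_le_add (by linarith) hs).trans ?_
    simp

theorem one_le_norm_sub_of_sector (h : UnitHexagon p q) {s t : ℝ} (hs : 0 ≤ s) (ht : 0 ≤ t)
    (hv : 1 ≤ ‖s • p + t • q‖) : 1 ≤ ‖(q - p) - (s • p + t • q)‖ := by
  rw [norm_sub_rev]
  rcases le_total 1 t with h1 | h1
  · have e : s • p + t • q - (q - p) = (s + 1) • p + (t - 1) • q := by module
    rw [e]
    have := h.le_norm' (s := s + 1) (t := t - 1) (by linarith) (by linarith)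
    linarith
  · have e : s • p + t • q - (q - p) = (s + t) • p + (1 - t) • (p - q) := by module
    rw [e]
    have := h.sub_right.le_norm' (s := s + t) (t := 1 - t) (by linarith) (by linarith)
    have := h.norm_le_add hs ht
    linarith

theorem one_le_norm_neg_sub_of_sector (h : UnitHexagon p q) {s t : ℝ} (hs : 0 ≤ s) (ht : 0 ≤ t) :
    1 ≤ ‖-p - (s • p + t • q)‖ := by
  have e : -p - (s • p + t • q) = -((s + 1) • p + t • q) := by module
  rw [e, norm_neg]
  have := h.le_norm' (s := s + 1) (t := t) (by linarith) ht
  linarith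

/-- Since `s ≤ 1 ≤ s + t`, the difference lies in the next sector, with coordinates summing to `t`.
-/
theorem norm_sub_left_le (h : UnitHexagon p q) {s t : ℝ} (hs : 0 ≤ s) (ht : 0 ≤ t)
    (hv : ‖s • p + t • q‖ = 1) : ‖s • p + t • q - p‖ ≤ t := by
  have h1 := h.le_norm' hs ht
  have h2 := h.norm_le_add hs ht
  have e : s • p + t • q - p = (s + t - 1) • q + (1 - s) • (q - p) := by module
  rw [e]
  refine (h.rotate.norm_le_add (by linarith) (by linarith)).trans ?_
  linarith

theorem ne_smul (h : UnitHexagon p q) (a : ℝ) : q ≠ a • p := by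
  rintro rfl
  have h1 := h.right
  have h2 := h.sub
  have e : a • p - p = (a - 1) • p := by module
  rw [e] at h2
  rw [norm_smul, h.left, mul_one, Real.norm_eq_abs] at h1 h2
  rcases abs_cases a with ⟨_, _⟩ | ⟨_, _⟩ <;> rcases abs_cases (a - 1) with ⟨_, _⟩ | ⟨_, _⟩ <;>
    linarith

theorem linearIndependent (h : UnitHexagon p q) : LinearIndependent ℝ ![p, q] := by
  have hp : p ≠ 0 := by
    rintro rfl
    simpa using h.left
  exact (LinearIndependent.pair_iff' hp).2 fun a ha => h.ne_smul a ha.symm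

end UnitHexagon

/-! ### Sectors, existence of hexagons, supporting functionals. -/

variable [NormedSpace ℝ F]

theorem exists_eq_combination (hF : Module.finrank ℝ F = 2) {p q : F}
    (h : LinearIndependent ℝ ![p, q]) (v : F) : ∃ a b : ℝ, v = a • p + b • q := by
  have : v ∈ Submodule.span ℝ (Set.range ![p, q]) := by
    rw [h.span_eq_top_of_card_eq_finrank (by simp [hF])]; trivial
  simp only [Matrix.range_cons, Matrix.range_empty, Set.union_empty, Set.singleton_union] at this
  obtain ⟨a, b, hab⟩ := Submodule.mem_span_pair.1 this
  exact ⟨a, b, hab.symm⟩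

/-- The six sectors spanned by consecutive vertices of a hexagon cover the plane. -/
theorem UnitHexagon.exists_sector (hF : Module.finrank ℝ F = 2) {p q : F} (h : UnitHexagon p q)
    (v : F) : ∃ s t : ℝ, 0 ≤ s ∧ 0 ≤ t ∧
      (v = s • p + t • q ∨ v = s • q + t • (q - p) ∨ v = s • (q - p) + t • (-p) ∨
        v = s • (-p) + t • (-q) ∨ v = s • (-q) + t • (p - q) ∨ v = s • (p - q) + t • p) := by
  obtain ⟨a, b, rfl⟩ := exists_eq_combination hF h.linearIndependent v
  rcases le_total 0 a with ha | ha <;> rcases le_total 0 b with hb | hb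
  · exact ⟨a, b, ha, hb, .inl rfl⟩
  · rcases le_total 0 (a + b) with hab | hab
    · exact ⟨-b, a + b, by linarith, hab, .inr <| .inr <| .inr <| .inr <| .inr <| by module⟩
    · exact ⟨-(a + b), a, by linarith, ha, .inr <| .inr <| .inr <| .inr <| .inl <| by module⟩
  · rcases le_total 0 (a + b) with hab | hab
    · exact ⟨a + b, -a, hab, by linarith, .inr <| .inl <| by module⟩
    · exact ⟨b, -(a + b), hb, by linarith, .inr <| .inr <| .inl <| by module⟩
  · exact ⟨-a, -b, by linarith, by linarith, .inr <| .inr <| .inr <| .inl <| by module⟩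

theorem isPreconnected_unitSphere (hF : Module.finrank ℝ F = 2) :
    IsPreconnected (Metric.sphere (0 : F) 1) := by
  have : FiniteDimensional ℝ F := Module.finite_of_finrank_pos (by omega)
  refine isPreconnected_sphere ?_ 0 1
  rw [← Module.finrank_eq_rank, hF]
  norm_num

theorem exists_norm_one (hF : Module.finrank ℝ F = 2) : ∃ p : F, ‖p‖ = 1 := by
  have : Nontrivial F := Module.nontrivial_of_finrank_pos (R := ℝ) (by omega)
  obtain ⟨p, hp⟩ := exists_ne (0 : F)
  exact ⟨‖p‖⁻¹ • p, norm_smul_inv_norm (𝕜 := ℝ) hp⟩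

/-- The distance to `p` runs from 0 at `p` to 2 at `-p` on the connected sphere, hence takes the
value 1. -/
theorem exists_unitHexagon (hF : Module.finrank ℝ F = 2) {p : F} (hp : ‖p‖ = 1) :
    ∃ q, UnitHexagon p q := by
  have hc : ContinuousOn (fun z : F => ‖z - p‖) (Metric.sphere (0 : F) 1) := by fun_prop
  have h2 : ‖-p - p‖ = 2 := by
    rw [show -p - p = (-2 : ℝ) • p by module, norm_smul, hp]; norm_num
  have := (isPreconnected_unitSphere hF).intermediate_value (a := p) (b := -p) (by simpa using hp)
    (by simpa using hp) hc
  obtain ⟨q, hq, hqp⟩ := this (show (1 : ℝ) ∈ _ by simp [h2])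
  exact ⟨q, hp, by simpa using hq, hqp⟩

theorem exists_support (p : F) (hp : ‖p‖ = 1) : ∃ f : F →L[ℝ] ℝ, (∀ x, |f x| ≤ ‖x‖) ∧ f p = 1 := by
  obtain ⟨f, hf, hfp⟩ := exists_dual_vector ℝ p (norm_ne_zero_iff.1 (by simp [hp]))
  refine ⟨f, fun x => ?_, by simpa [hp] using hfp⟩
  have := f.le_opNorm x
  rwa [hf, one_mul] at this

/-! ### Three open balls do not cover the circle. -/

theorem UnitHexagon.count_of_sector {p q : F} (h : UnitHexagon p q) {v : F} (hv : 1 ≤ ‖v‖)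
    {s t : ℝ} (hs : 0 ≤ s) (ht : 0 ≤ t) (e : v = s • p + t • q) :
    ballIndicator v p + ballIndicator v q + ballIndicator v (q - p) + ballIndicator v (-p) +
      ballIndicator v (-q) + ballIndicator v (p - q) ≤ 2 := by
  have e' : v = t • q + s • p := by rw [e, add_comm]
  have h1 : ballIndicator v (q - p) = 0 := ballIndicator_eq_zero <| by
    rw [e]; exact h.one_le_norm_sub_of_sector hs ht (e ▸ hv)
  have h2 : ballIndicator v (p - q) = 0 := ballIndicator_eq_zero <| by
    rw [e']; exact h.symm.one_le_norm_sub_of_sector ht hs (e' ▸ hv)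
  have h3 : ballIndicator v (-p) = 0 := ballIndicator_eq_zero <| by
    rw [e]; exact h.one_le_norm_neg_sub_of_sector hs ht
  have h4 : ballIndicator v (-q) = 0 := ballIndicator_eq_zero <| by
    rw [e']; exact h.symm.one_le_norm_neg_sub_of_sector ht hs
  have := ballIndicator_le_one v p
  have := ballIndicator_le_one v q
  omega

theorem UnitHexagon.count_le (hF : Module.finrank ℝ F = 2) {p q : F} (h : UnitHexagon p q) {v : F}
    (hv : 1 ≤ ‖v‖) :
    ballIndicator v p + ballIndicator v q + ballIndicator v (q - p) + ballIndicator v (-p) +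
      ballIndicator v (-q) + ballIndicator v (p - q) ≤ 2 := by
  obtain ⟨s, t, hs, ht, H⟩ := h.exists_sector hF v
  rcases H with H | H | H | H | H | H
  · exact h.count_of_sector hv hs ht H
  · have := h.rotate.count_of_sector hv hs ht H
    rw [show q - p - q = -p by abel, show q - (q - p) = p by abel, neg_sub] at this
    omega
  · have := h.rotate_rotate.count_of_sector hv hs ht H
    rw [show -p - (q - p) = -q by abel, sub_neg_eq_add, sub_add_cancel, neg_sub, neg_neg] at this
    omega
  · have := h.neg.count_of_sector hv hs ht H
    rw [neg_sub_neg, neg_sub_neg, neg_neg, neg_neg] at this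
    omega
  · have := h.neg_rotate.count_of_sector hv hs ht H
    rw [sub_neg_eq_add, sub_add_cancel, show -q - (p - q) = -p by abel, neg_neg, neg_sub] at this
    omega
  · have := h.neg_rotate_rotate.count_of_sector hv hs ht H
    rw [sub_sub_cancel, show p - q - p = -q by abel, neg_sub] at this
    omega

theorem one_le_norm_neg_sub {v x : F} (hv : 1 ≤ ‖v‖) (hx : ‖x - v‖ < 1) : 1 ≤ ‖-x - v‖ := by
  have e : (-2 : ℝ) • v = (x - v) + (-x - v) := by module
  have := norm_add_le (x - v) (-x - v)
  rw [← e, norm_smul] at this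
  norm_num at this
  linarith

/-- The unit circle of a normed plane is not covered by three open unit balls whose centres have
norm at least one. -/
theorem four_le_card_of_cover (hF : Module.finrank ℝ F = 2) {ι : Type*} [Fintype ι] (v : ι → F)
    (hv : ∀ i, 1 ≤ ‖v i‖) (hcov : ∀ x : F, ‖x‖ = 1 → ∃ i, ‖x - v i‖ < 1) :
    4 ≤ Fintype.card ι := by
  classical
  by_contra! hcard
  have hpos : ∀ x : F, ‖x‖ = 1 → 1 ≤ ∑ i, ballIndicator (v i) x := fun x hx => by
    obtain ⟨i, hi⟩ := hcov x hx
    rw [← ballIndicator_eq_one hi]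
    exact Finset.single_le_sum (f := fun i => ballIndicator (v i) x) (fun _ _ => Nat.zero_le _)
      (Finset.mem_univ i)
  -- At most three balls, with at most two vertices each, account for at most six incidences; all
  -- six vertices need one, so `p` gets no second.
  have hone : ∀ x : F, ‖x‖ = 1 → ∑ i, ballIndicator (v i) x ≤ 1 := fun p hp => by
    obtain ⟨q, h⟩ := exists_unitHexagon hF hp
    have hsum := Finset.sum_le_card_nsmul Finset.univ _ 2 fun i _ => h.count_le hF (hv i)
    simp only [Finset.sum_add_distrib, Finset.card_univ, smul_eq_mul] at hsum
    have := hpos q h.right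
    have := hpos (q - p) h.sub
    have := hpos (-p) h.neg.left
    have := hpos (-q) h.neg.right
    have := hpos (p - q) h.symm.sub
    omega
  obtain ⟨p, hp⟩ := exists_norm_one hF
  obtain ⟨i, hi⟩ := hcov p hp
  have hopen : ∀ j, IsOpen {x : F | ‖x - v j‖ < 1} := fun j =>
    isOpen_lt (by fun_prop) continuous_const
  -- Ball `i` contains `p` but not `-p`, so both open sets meet the sphere, and connectedness yields
  -- a doubly covered point.
  obtain ⟨z, hz, hzi, hzj⟩ := isPreconnected_unitSphere hF {x : F | ‖x - v i‖ < 1}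
    (⋃ j ∈ {j | j ≠ i}, {x : F | ‖x - v j‖ < 1}) (hopen i)
    (isOpen_biUnion fun j _ => hopen j)
    (fun x hx => by
      obtain ⟨j, hj⟩ := hcov x (by simpa using hx)
      by_cases hji : j = i
      · exact Or.inl (hji ▸ hj)
      · exact Or.inr (Set.mem_biUnion (show j ∈ {j | j ≠ i} from hji) hj))
    ⟨p, by simpa using hp, hi⟩
    (by
      obtain ⟨j, hj⟩ := hcov (-p) (by simpa using hp)
      refine ⟨-p, by simpa using hp, Set.mem_biUnion (show j ∈ {j | j ≠ i} from ?_) hj⟩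
      rintro rfl
      exact absurd (one_le_norm_neg_sub (hv j) hi) (not_le.2 hj))
  simp only [Set.mem_iUnion] at hzj
  obtain ⟨j, hji, hj⟩ := hzj
  have h1 := hone z (by simpa using hz)
  have h2 := Finset.sum_le_sum_of_subset (f := fun i => ballIndicator (v i) z)
    (Finset.subset_univ {i, j})
  rw [Finset.sum_pair (Ne.symm hji), ballIndicator_eq_one hzi, ballIndicator_eq_one hj] at h2
  omega

/-! ### Parallelogram balls and covers by closed balls. -/

/-- The unit ball of `F` is a parallelogram. -/
def HasParallelogramBall (F : Type*) [NormedAddCommGroup F] [NormedSpace ℝ F] : Prop :=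
  ∃ u w : F, LinearIndependent ℝ ![u, w] ∧
    ∀ a b : ℝ, ‖a • u + b • w‖ ≤ 1 ↔ |a| ≤ 1 ∧ |b| ≤ 1

/-- A functional supporting the ball at `u` must vanish on `w`, so it reads off the coordinate `a`.
-/
theorem abs_left_le_norm {u w : F} (hu : ‖u‖ = 1) (h1 : ‖u + w‖ ≤ 1)
    (h2 : ‖u - w‖ ≤ 1) (a b : ℝ) : |a| ≤ ‖a • u + b • w‖ := by
  obtain ⟨f, hf, hfu⟩ := exists_support u hu
  have h3 := (abs_le.1 ((hf _).trans h1)).2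
  have h4 := (abs_le.1 ((hf _).trans h2)).2
  rw [map_add, hfu] at h3
  rw [map_sub, hfu] at h4
  have h0 : f w = 0 := by linarith
  have := hf (a • u + b • w)
  simpa [hfu, h0] using this

theorem norm_combination_le_one_iff {u w : F} (hu : ‖u‖ = 1) (hw : ‖w‖ = 1) (h1 : ‖u + w‖ ≤ 1)
    (h2 : ‖u - w‖ ≤ 1) (a b : ℝ) : ‖a • u + b • w‖ ≤ 1 ↔ |a| ≤ 1 ∧ |b| ≤ 1 := by
  constructor
  · intro h
    refine ⟨(abs_left_le_norm hu h1 h2 a b).trans h, ?_⟩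
    refine (abs_left_le_norm hw (by rwa [add_comm]) (by rwa [norm_sub_rev]) b a).trans ?_
    rwa [add_comm]
  · rintro ⟨ha, hb⟩
    have e : a • u + b • w = ((a + b) / 2) • (u + w) + ((a - b) / 2) • (u - w) := by module
    rw [e]
    refine (norm_add_le _ _).trans ?_
    rw [norm_smul, norm_smul, Real.norm_eq_abs, Real.norm_eq_abs]
    have h3 := mul_le_of_le_one_right (abs_nonneg ((a + b) / 2)) h1
    have h4 := mul_le_of_le_one_right (abs_nonneg ((a - b) / 2)) h2
    have h5 : |(a + b) / 2| + |(a - b) / 2| ≤ 1 := by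
      rw [abs_le] at ha hb
      rcases abs_cases ((a + b) / 2) with ⟨h, _⟩ | ⟨h, _⟩ <;>
      rcases abs_cases ((a - b) / 2) with ⟨h', _⟩ | ⟨h', _⟩ <;> rw [h, h'] <;> linarith
    linarith

theorem hasParallelogramBall_of_norm_le_one {u w : F} (hu : ‖u‖ = 1) (hw : ‖w‖ = 1)
    (h1 : ‖u + w‖ ≤ 1) (h2 : ‖u - w‖ ≤ 1) : HasParallelogramBall F := by
  refine ⟨u, w, ?_, norm_combination_le_one_iff hu hw h1 h2⟩
  rw [LinearIndependent.pair_iff]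
  intro a b hab
  have h3 := abs_left_le_norm hu h1 h2 a b
  have h4 := abs_left_le_norm hw (by rwa [add_comm]) (by rwa [norm_sub_rev]) b a
  rw [add_comm, hab, norm_zero] at h4
  rw [hab, norm_zero] at h3
  exact ⟨abs_nonpos_iff.1 h3, abs_nonpos_iff.1 h4⟩

theorem UnitHexagon.one_lt_norm_add {p q : F} (h : UnitHexagon p q)
    (hP : ¬ HasParallelogramBall F) : 1 < ‖p + q‖ := by
  by_contra! h1
  exact hP (hasParallelogramBall_of_norm_le_one h.left h.right h1 h.symm.sub.le)

/-- If two closed unit balls centred on the unit circle cover it, then the unit ball is a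
parallelogram. -/
theorem hasParallelogramBall_of_cover_two (hF : Module.finrank ℝ F = 2) {u w : F} (hu : ‖u‖ = 1)
    (hw : ‖w‖ = 1) (hcov : ∀ x : F, ‖x‖ = 1 → ‖x - u‖ ≤ 1 ∨ ‖x - w‖ ≤ 1) :
    HasParallelogramBall F := by
  have aux : ∀ {u x : F}, ‖u‖ = 1 → ‖x‖ = 1 → ‖x - u‖ ≤ 1 → ‖-x - u‖ ≤ 1 →
      HasParallelogramBall F := fun {u x} hu hx h1 h2 => by
    refine hasParallelogramBall_of_norm_le_one hx hu ?_ h1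
    rwa [← norm_neg, show -(x + u) = -x - u by abel]
  have hcl : ∀ {f : F → F}, Continuous f → IsClosed {x : F | ‖f x - u‖ ≤ 1} := fun hf =>
    isClosed_le (by fun_prop) continuous_const
  by_contra hP
  -- By `aux` the ball around `w` contains no antipodal unit vectors, so the ball around `u` and its
  -- reflection cover the sphere. They must meet, which gives antipodal points in the ball around
  -- `u`.
  obtain ⟨z, hz, h1, h2⟩ := isPreconnected_closed_iff.1 (isPreconnected_unitSphere hF)
    {x : F | ‖x - u‖ ≤ 1} {x : F | ‖-x - u‖ ≤ 1} (hcl continuous_id) (hcl continuous_neg)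
    (fun x hx => by
      have hx : ‖x‖ = 1 := by simpa using hx
      rcases hcov x hx with h | h
      · exact Or.inl h
      · rcases hcov (-x) (by simpa using hx) with h' | h'
        · exact Or.inr h'
        · exact absurd (aux hw hx h h') hP)
    ⟨u, by simpa using hu, by simp⟩ ⟨-u, by simpa using hu, by simp⟩
  exact hP (aux hu (by simpa using hz) h1 h2)

/-- Alternate hexagon vertices: each closed ball covers the arcs of its two adjacent sectors, and
the difference of two such vertices is, up to sign, a sum of adjacent vertices, long by
`one_lt_norm_add`. -/
theorem exists_strict_cover_three (hF : Module.finrank ℝ F = 2) (hP : ¬ HasParallelogramBall F) :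
    ∃ a b c : F, ‖a‖ = 1 ∧ ‖b‖ = 1 ∧ ‖c‖ = 1 ∧ 1 < ‖a - b‖ ∧ 1 < ‖a - c‖ ∧ 1 < ‖b - c‖ ∧
      ∀ x : F, ‖x‖ = 1 → ‖x - a‖ ≤ 1 ∨ ‖x - b‖ ≤ 1 ∨ ‖x - c‖ ≤ 1 := by
  obtain ⟨p, hp⟩ := exists_norm_one hF
  obtain ⟨q, h⟩ := exists_unitHexagon hF hp
  have left_le : ∀ {p q : F}, UnitHexagon p q → ∀ {s t : ℝ}, 0 ≤ s → 0 ≤ t →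
      ‖s • p + t • q‖ = 1 → ‖s • p + t • q - p‖ ≤ 1 := fun {p q} h {s t} hs ht hv =>
    (h.norm_sub_left_le hs ht hv).trans ((h.le_norm hs ht).trans hv.le)
  have right_le : ∀ {p q : F}, UnitHexagon p q → ∀ {s t : ℝ}, 0 ≤ s → 0 ≤ t →
      ‖s • p + t • q‖ = 1 → ‖s • p + t • q - q‖ ≤ 1 := fun {p q} h {s t} hs ht hv => by
    rw [add_comm] at hv ⊢; exact left_le h.symm ht hs hv
  refine ⟨p, q - p, -q, h.left, h.sub, h.neg.right, ?_, ?_, ?_, fun x hx => ?_⟩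
  · have := h.sub_right.one_lt_norm_add hP
    rwa [show p - (q - p) = p + (p - q) by abel]
  · have := h.one_lt_norm_add hP
    rwa [sub_neg_eq_add]
  · have := h.rotate.one_lt_norm_add hP
    rwa [show q - p - -q = q + (q - p) by abel]
  · obtain ⟨s, t, hs, ht, rfl | rfl | rfl | rfl | rfl | rfl⟩ := h.exists_sector hF x
    · exact Or.inl (left_le h hs ht hx)
    · exact Or.inr (Or.inl (right_le h.rotate hs ht hx))
    · exact Or.inr (Or.inl (left_le h.rotate_rotate hs ht hx))
    · exact Or.inr (Or.inr (right_le h.neg hs ht hx))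
    · exact Or.inr (Or.inr (left_le h.neg_rotate hs ht hx))
    · exact Or.inl (right_le h.neg_rotate_rotate hs ht hx)

/-! ### Long segments on the circle and the cover by four open balls. -/

/-- No segment from `q - p` to `q + s • p` with `0 < s` (so of length more than `‖p‖ = 1`) lies on
the unit sphere. -/
def NoLongSegment (p : F) : Prop :=
  ∀ q : F, UnitHexagon p q → ∀ s : ℝ, 0 < s → ‖q + s • p‖ ≠ 1

/-- The functional attains its maximum over the ball at `q`, strictly between `q - p` and `q + s •
p`, so it is constant along that segment. -/
theorem UnitHexagon.support_eq_zero {p q : F} (h : UnitHexagon p q) {s : ℝ} (hs : 0 < s)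
    (hsp : ‖q + s • p‖ ≤ 1) {f : F →L[ℝ] ℝ} (hf : ∀ x, |f x| ≤ ‖x‖) (hq : f q = 1) : f p = 0 := by
  have h1 := (abs_le.1 ((hf _).trans hsp)).2
  have h2 := (abs_le.1 ((hf _).trans h.sub.le)).2
  rw [map_add, map_smul, smul_eq_mul, hq] at h1
  rw [map_sub, hq] at h2
  nlinarith

/-- The unit sphere contains a segment of length one, from `y` to `y + d`. -/
def SphereHasUnitSegment (F : Type*) [NormedAddCommGroup F] [NormedSpace ℝ F] : Prop :=
  ∃ (f : F →L[ℝ] ℝ) (y d : F), (∀ x, |f x| ≤ ‖x‖) ∧ ‖d‖ = 1 ∧ ‖y‖ ≤ 1 ∧ ‖y + d‖ ≤ 1 ∧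
    f y = 1 ∧ f d = 0

theorem UnitHexagon.sphereHasUnitSegment {p q : F} (h : UnitHexagon p q) {s : ℝ} (hs : 0 < s)
    (hsp : ‖q + s • p‖ ≤ 1) : SphereHasUnitSegment F := by
  obtain ⟨f, hf, hq⟩ := exists_support q h.right
  have h0 := h.support_eq_zero hs hsp hf hq
  exact ⟨f, q - p, p, hf, h.left, h.sub.le, by rw [sub_add_cancel]; exact h.right.le,
    by rw [map_sub, hq, h0, sub_zero], h0⟩

/-- If a functional `f` of norm one supports the unit ball at `p` and `d` is a unit vector in its
kernel, then a long segment parallel to `p` passes through `d` or `-d`. -/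
theorem UnitHexagon.exists_smul_add (hF : Module.finrank ℝ F = 2) {p q : F} (h : UnitHexagon p q)
    {s : ℝ} (hs : 0 < s) (hsp : ‖q + s • p‖ ≤ 1) {f : F →L[ℝ] ℝ} (hf : ∀ x, |f x| ≤ ‖x‖)
    (hp : f p = 1) {d : F} (hd : ‖d‖ = 1) (hfd : f d = 0) :
    ∃ t a b : ℝ, |t| = 1 ∧ a < 0 ∧ 0 < b ∧ ‖t • d + a • p‖ ≤ 1 ∧ ‖t • d + b • p‖ ≤ 1 ∧
      ∃ g : F →L[ℝ] ℝ, (∀ x, |g x| ≤ ‖x‖) ∧ g p = 0 ∧ g (t • d) = 1 := by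
  obtain ⟨g, hg, hq⟩ := exists_support q h.right
  have h0 := h.support_eq_zero hs hsp hg hq
  have hli : LinearIndependent ℝ ![p, d] := by
    rw [LinearIndependent.pair_iff]
    intro a b hab
    have h1 : a = 0 := by simpa [hp, hfd] using congrArg f hab
    have hd0 : d ≠ 0 := norm_ne_zero_iff.1 (by simp [hd])
    rw [h1, zero_smul, zero_add, smul_eq_zero] at hab
    exact ⟨h1, hab.resolve_right hd0⟩
  obtain ⟨c, t, hct⟩ := exists_eq_combination hF hli q
  have hfq : f q = c := by simp [hct, hp, hfd]
  -- Evaluating `f` at the two ends of the segment gives `0 ≤ c ≤ 1 - s`, so `t • d` is a convex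
  -- combination of `q` and `q - p`.
  have h1 := (abs_le.1 ((hf _).trans hsp)).2
  have h2 := (abs_le.1 ((hf _).trans h.sub.le)).1
  rw [map_add, map_smul, smul_eq_mul, hfq, hp] at h1
  rw [map_sub, hfq, hp] at h2
  have htd : t • d = (1 - c) • q + c • (q - p) := by rw [hct]; module
  have hgt : g (t • d) = 1 := by simp [htd, hq, h0]
  refine ⟨t, c - 1, c + s, le_antisymm ?_ ?_, by linarith, by linarith, ?_, ?_, g, hg, h0, hgt⟩
  · have : ‖t • d‖ ≤ 1 := by
      rw [htd]
      refine (norm_add_le _ _).trans ?_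
      rw [norm_smul, norm_smul, h.right, h.sub, Real.norm_of_nonneg (by linarith),
        Real.norm_of_nonneg (by linarith)]
      linarith
    rwa [norm_smul, hd, mul_one] at this
  · have := hg (t • d)
    rwa [hgt, norm_smul, hd, mul_one, abs_one] at this
  · rw [show t • d + (c - 1) • p = q - p by rw [hct]; module]
    exact h.sub.le
  · rwa [show t • d + (c + s) • p = q + s • p by rw [hct]; module]

/-- Of two points on a segment in the unit sphere, at least one is parallel to no long segment. -/
theorem noLongSegment_or (hF : Module.finrank ℝ F = 2) {f : F →L[ℝ] ℝ} (hf : ∀ x, |f x| ≤ ‖x‖)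
    {p d : F} {r : ℝ} (hr : r ≠ 0) (hd : ‖d‖ = 1) (hp : f p = 1) (hfd : f d = 0) :
    NoLongSegment p ∨ NoLongSegment (p + r • d) := by
  by_contra! H
  simp only [NoLongSegment, not_forall, ne_eq, not_not] at H
  obtain ⟨⟨q, h, s, hs, hsp⟩, q', h', s', hs', hsp'⟩ := H
  obtain ⟨t, -, -, ht, -, -, -, -, g, hg, hgp, hgd⟩ := h.exists_smul_add hF hs hsp.le hf hp hd hfd
  obtain ⟨t', a, b, ht', ha, hb, hna, hnb, -⟩ :=
    h'.exists_smul_add hF hs' hsp'.le hf (by simp [hp, hfd]) hd hfd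
  -- At `t' • d` the functional `g` has the extreme value 1 or -1, yet it is not constant in the
  -- direction `p + r • d`; moving both ways leaves the interval `[-1, 1]`.
  have h1 := (hg _).trans hna
  have h2 := (hg _).trans hnb
  have hgd' : g d ≠ 0 := fun h0 => by simp [h0] at hgd
  have h4 : |t' * g d| = 1 := by
    have := congrArg abs hgd
    rwa [map_smul, smul_eq_mul, abs_mul, ht, ← ht', ← abs_mul, ht', abs_one] at this
  have h5 : r * g d ≠ 0 := mul_ne_zero hr hgd'
  simp only [map_add, map_smul, smul_eq_mul, hgp, zero_add] at h1 h2
  rw [abs_le] at h1 h2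
  rcases h5.lt_or_gt with h5 | h5 <;> rcases eq_or_eq_neg_of_abs_eq h4 with h4 | h4 <;>
    rw [h4] at h1 h2 <;> nlinarith

theorem exists_good_direction (hF : Module.finrank ℝ F = 2) : ∃ p : F, ‖p‖ = 1 ∧
    NoLongSegment p ∧ ∀ q, UnitHexagon p q → 1 < ‖q + (q - p)‖ := by
  by_cases hS : SphereHasUnitSegment F
  · obtain ⟨f, y, d, hf, hd, hy, hyd, hfy, hfd⟩ := hS
    have hnorm : ∀ r : ℝ, 0 ≤ r → r ≤ 1 → ‖y + r • d‖ = 1 := fun r h0 h1 => by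
      refine le_antisymm ?_ ?_
      · rw [show y + r • d = (1 - r) • y + r • (y + d) by module]
        refine (norm_add_le _ _).trans ?_
        rw [norm_smul, norm_smul, Real.norm_of_nonneg h0, Real.norm_of_nonneg (by linarith)]
        nlinarith
      · have := hf (y + r • d)
        simpa [hfy, hfd] using this
    -- Otherwise the ball is a parallelogram in the coordinates of `q` and `q - p`, where `p = y + r
    -- • d` is the corner `(1, -1)`; a corner is not interior to a segment of the ball.
    have hcorner : ∀ r : ℝ, 0 < r → r < 1 → ∀ q, UnitHexagon (y + r • d) q →
        1 < ‖q + (q - (y + r • d))‖ := fun r h0 h1 q h => by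
      by_contra! hq
      have key := norm_combination_le_one_iff h.right h.sub hq (by rw [sub_sub_cancel]; exact h.left.le)
      obtain ⟨a, b, hab⟩ := exists_eq_combination hF h.rotate.linearIndependent d
      have hy' : y = (1 - r * a) • q + (-1 - r * b) • (q - (y + r • d)) := by
        have : y = (y + r • d) - r • (a • q + b • (q - (y + r • d))) := by
          rw [← hab]; abel
        nth_rw 1 [this]
        module
      have hyd' : y + d = (1 + (1 - r) * a) • q + (-1 + (1 - r) * b) • (q - (y + r • d)) := by
        have : y + d = (y + r • d) + (1 - r) • (a • q + b • (q - (y + r • d))) := by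
          rw [← hab]; module
        nth_rw 1 [this]
        module
      rw [hy', key, abs_le, abs_le] at hy
      rw [hyd', key, abs_le, abs_le] at hyd
      have ha : a = 0 := by nlinarith
      have hb : b = 0 := by nlinarith
      rw [ha, hb, zero_smul, zero_smul, add_zero] at hab
      simp [hab] at hd
    rcases noLongSegment_or hF hf (r := 1 / 3) (p := y + (1 / 3 : ℝ) • d) (by norm_num) hd
      (by simp [hfy, hfd]) hfd with H | H
    · exact ⟨_, hnorm _ (by norm_num) (by norm_num), H, hcorner _ (by norm_num) (by norm_num)⟩
    · rw [show y + (1 / 3 : ℝ) • d + (1 / 3 : ℝ) • d = y + (2 / 3 : ℝ) • d by module] at H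
      exact ⟨_, hnorm _ (by norm_num) (by norm_num), H, hcorner _ (by norm_num) (by norm_num)⟩
  · obtain ⟨p, hp⟩ := exists_norm_one hF
    refine ⟨p, hp, fun q h s hs hsp => hS (h.sphereHasUnitSegment hs hsp.le), fun q h => ?_⟩
    by_contra! hq
    exact hS (h.rotate.symm.sphereHasUnitSegment one_pos (by rwa [one_smul]))

/-- The point `c • (p + q)` with `0 < c < 1` is at distance less than one from every unit vector
between the adjacent vertices `p` and `q` of a hexagon. -/
theorem UnitHexagon.norm_sub_lt_one {p q : F} (h : UnitHexagon p q) {c : ℝ} (h0 : 0 < c)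
    (h1 : c < 1) {s t : ℝ} (hs : 0 ≤ s) (ht : 0 ≤ t)
    (hst : ‖s • p + t • q‖ = 1) : ‖s • p + t • q - c • (p + q)‖ < 1 := by
  have h2 := h.le_norm' hs ht
  have h3 := h.le_norm hs ht
  have h4 := h.norm_le_add hs ht
  rw [hst] at h2 h3 h4
  rcases le_total c s with hcs | hcs <;> rcases le_total c t with hct | hct
  · rw [show s • p + t • q - c • (p + q) = (s - c) • p + (t - c) • q by module]
    refine (h.norm_mono (s' := (1 - c) * s) (t' := (1 - c) * t) (by linarith) (by nlinarith)
      (by linarith) (by nlinarith)).trans_lt ?_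
    rw [mul_smul, mul_smul, ← smul_add, norm_smul, hst, Real.norm_of_nonneg (by linarith)]
    linarith
  · rw [show s • p + t • q - c • (p + q) = (s - c) • p - (c - t) • q by module]
    refine (h.norm_sub_le_max (by linarith) (by linarith)).trans_lt (max_lt ?_ ?_) <;> linarith
  · rw [show s • p + t • q - c • (p + q) = (t - c) • q - (c - s) • p by module]
    refine (h.symm.norm_sub_le_max (by linarith) (by linarith)).trans_lt (max_lt ?_ ?_) <;> linarith
  · rw [norm_sub_rev, show c • (p + q) - (s • p + t • q) = (c - s) • p + (c - t) • q by module]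
    refine (h.norm_le_add (by linarith) (by linarith)).trans_lt ?_
    linarith

/-- The vector `x` covers the closed arc from `q` to `q - p`, since the corner condition makes `c <
1`. The balls at `p` and `-p` cover the two neighbouring arcs up to the endpoints `q` and `q - p`.
-/
theorem exists_cover_four (hF : Module.finrank ℝ F = 2) :
    ∃ p x : F, ‖p‖ = 1 ∧ ‖x‖ = 1 ∧ 1 ≤ ‖x - p‖ ∧ 1 ≤ ‖x + p‖ ∧
      ∀ z : F, ‖z‖ = 1 → ‖z - p‖ < 1 ∨ ‖z + p‖ < 1 ∨ ‖z - x‖ < 1 ∨ ‖z + x‖ < 1 := by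
  obtain ⟨p, hp, hlong, hcorner⟩ := exists_good_direction hF
  obtain ⟨q, h⟩ := exists_unitHexagon hF hp
  have hN := hcorner q h
  set c : ℝ := ‖q + (q - p)‖⁻¹
  have hc0 : 0 < c := inv_pos.2 (by linarith)
  have hc1 : c < 1 := inv_lt_one_of_one_lt₀ hN
  have hx : ‖c • (q + (q - p))‖ = 1 := by
    rw [norm_smul, Real.norm_of_nonneg hc0.le, inv_mul_cancel₀ (by linarith)]
  have hx' : c • q + c • (q - p) = c • (q + (q - p)) := by module
  -- Here `‖z - p‖ ≤ t ≤ 1`. If `t = 1`, then `z = q + s • p`, and the absence of long segments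
  -- forces `s = 0`.
  have half : ∀ {p q z : F} {s t : ℝ}, UnitHexagon p q → NoLongSegment p → 0 ≤ s → 0 ≤ t →
      ‖z‖ = 1 → z = s • p + t • q → ‖z - p‖ < 1 ∨ z = q := by
    rintro p q _ s t h hl hs ht hz rfl
    have h1 := h.norm_sub_left_le hs ht hz
    have h2 := h.le_norm hs ht
    rw [hz] at h2
    rcases h2.lt_or_eq with h2 | rfl
    · exact Or.inl (h1.trans_lt h2)
    · rcases hs.lt_or_eq with hs | rfl
      · rw [add_comm, one_smul] at hz
        exact absurd hz (hl q h s hs)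
      · right; simp
  have hlong' : NoLongSegment (-p) := fun q' h' s hs hsp => by
    refine hlong (-q') (by simpa using h'.neg) s hs ?_
    rw [← hsp, ← norm_neg, neg_add, neg_neg, ← smul_neg]
  have mid : ∀ {z : F} {s t : ℝ}, 0 ≤ s → 0 ≤ t → ‖z‖ = 1 → z = s • q + t • (q - p) →
      ‖z - c • (q + (q - p))‖ < 1 := by
    rintro _ s t hs ht hz rfl
    exact h.rotate.norm_sub_lt_one hc0 hc1 hs ht hz
  -- half of the sphere; the other half follows by symmetry
  have main : ∀ {z : F} {s t : ℝ}, 0 ≤ s → 0 ≤ t → ‖z‖ = 1 →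
      (z = s • p + t • q ∨ z = s • q + t • (q - p) ∨ z = s • (q - p) + t • (-p)) →
      ‖z - p‖ < 1 ∨ ‖z + p‖ < 1 ∨ ‖z - c • (q + (q - p))‖ < 1 := by
    rintro z s t hs ht hz (H | H | H)
    · rcases half h hlong hs ht hz H with H | H
      · exact Or.inl H
      · exact Or.inr (Or.inr (mid zero_le_one le_rfl hz (by simpa using H)))
    · exact Or.inr (Or.inr (mid hs ht hz H))
    · rw [add_comm] at H
      rcases half h.rotate_rotate.symm hlong' ht hs hz H with H | H
      · rw [sub_neg_eq_add] at H
        exact Or.inr (Or.inl H)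
      · exact Or.inr (Or.inr (mid le_rfl zero_le_one hz (by simpa using H)))
  refine ⟨p, c • (q + (q - p)), hp, hx, ?_, ?_, fun z hz => ?_⟩
  · have := h.rotate.symm.one_le_norm_sub_of_sector hc0.le hc0.le
      (by rw [add_comm, hx']; exact hx.ge)
    rw [sub_sub_cancel] at this
    rw [norm_sub_rev, ← hx', add_comm]
    exact this
  · have := h.rotate.one_le_norm_sub_of_sector hc0.le hc0.le (by rw [hx']; exact hx.ge)
    rw [show q - p - q = -p by abel] at this
    rw [← norm_neg, ← hx', neg_add_rev, ← sub_eq_add_neg]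
    exact this
  · have e : ∀ a b : F, ‖-a - b‖ = ‖a + b‖ := fun a b => by
      rw [← norm_neg, neg_sub, sub_neg_eq_add, add_comm]
    have e' : ∀ a b : F, ‖-a + b‖ = ‖a - b‖ := fun a b => by
      rw [← norm_neg, neg_add, neg_neg, sub_eq_add_neg]
    obtain ⟨s, t, hs, ht, H | H | H | H | H | H⟩ := h.exists_sector hF z
    · have := main hs ht hz (Or.inl H); tauto
    · have := main hs ht hz (Or.inr (Or.inl H)); tauto
    · have := main hs ht hz (Or.inr (Or.inr H)); tauto
    all_goals
      have hz' : ‖-z‖ = 1 := by rwa [norm_neg]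
    · have := main hs ht hz' (Or.inl (by rw [H]; module))
      rw [e, e', e] at this; tauto
    · have := main hs ht hz' (Or.inr (Or.inl (by rw [H]; module)))
      rw [e, e', e] at this; tauto
    · have := main hs ht hz' (Or.inr (Or.inr (by rw [H]; module)))
      rw [e, e', e] at this; tauto

theorem HasParallelogramBall.exists_strict_cover_two (hF : Module.finrank ℝ F = 2)
    (hP : HasParallelogramBall F) :
    ∃ u : F, ‖u‖ = 1 ∧ ∀ x : F, ‖x‖ = 1 → ‖x - u‖ ≤ 1 ∨ ‖x + u‖ ≤ 1 := by
  obtain ⟨u, w, hli, key⟩ := hP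
  have hu : ‖u‖ ≤ 1 := by simpa using (key 1 0).2 (by simp)
  have hu0 : 0 < ‖u‖ := norm_pos_iff.2 (hli.ne_zero 0)
  refine ⟨u, le_antisymm hu ?_, fun x hx => ?_⟩
  · have := ((key ‖u‖⁻¹ 0).1 (by
      rw [zero_smul, add_zero, norm_smul, norm_inv, norm_norm, inv_mul_cancel₀ hu0.ne'])).1
    rw [abs_of_pos (inv_pos.2 hu0)] at this
    exact (inv_le_one₀ hu0).1 this
  · obtain ⟨a, b, rfl⟩ := exists_eq_combination hF hli x
    obtain ⟨ha, hb⟩ := (key a b).1 hx.le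
    rw [abs_le] at ha
    rcases le_total 0 a with h | h
    · left
      rw [show a • u + b • w - u = (a - 1) • u + b • w by module, key, abs_le]
      exact ⟨⟨by linarith, by linarith⟩, hb⟩
    · right
      rw [show a • u + b • w + u = (a + 1) • u + b • w by module, key, abs_le]
      exact ⟨⟨by linarith, by linarith⟩, hb⟩

end NormedPlane

/-! ### From a convex disc to the norm of its difference body. -/

section Transfer

theorem vadd_inter_vadd_nonempty {E : Type*} [AddCommGroup E] {A B : Set E} {x y : E} :
    ((x +ᵥ A) ∩ (y +ᵥ B)).Nonempty ↔ x - y ∈ B - A := by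
  constructor
  · rintro ⟨_, ⟨a, ha, rfl⟩, b, hb, hab⟩
    refine ⟨b, hb, a, ha, ?_⟩
    rw [sub_eq_sub_iff_add_eq_add, add_comm, add_comm x] at *
    simpa [add_comm] using hab
  · rintro ⟨b, hb, a, ha, hab⟩
    refine ⟨x + a, ⟨a, ha, rfl⟩, b, hb, ?_⟩
    rw [sub_eq_sub_iff_add_eq_add] at hab
    simpa [add_comm] using hab

theorem overlap_vadd_iff {C : Set (EuclideanSpace ℝ (Fin 2))} {x y : EuclideanSpace ℝ (Fin 2)} :
    Overlap (x +ᵥ C) (y +ᵥ C) ↔ x - y ∈ interior C - interior C := by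
  rw [Overlap, interior_vadd, interior_vadd, vadd_inter_vadd_nonempty]

/-- Packaging the norm on a separate type `F` keeps it apart from the Euclidean norm already on the
plane. -/
theorem exists_normedSpace_of_norm {E : Type} [AddCommGroup E] [Module ℝ E] (N : E → ℝ)
    (h0 : ∀ x, 0 ≤ N x) (hsmul : ∀ (r : ℝ) x, N (r • x) = ‖r‖ * N x)
    (hadd : ∀ x y, N (x + y) ≤ N x + N y) (hN : ∀ x, N x = 0 ↔ x = 0) :
    ∃ (F : Type) (_ : NormedAddCommGroup F) (_ : NormedSpace ℝ F) (e : E ≃ₗ[ℝ] F),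
      ∀ x, ‖e x‖ = N x := by
  let _ : Norm E := ⟨N⟩
  have core : NormedSpace.Core ℝ E := ⟨⟨h0, hsmul, hadd⟩, hN⟩
  let _ : NormedAddCommGroup E := NormedAddCommGroup.ofCore core
  let _ : NormedSpace ℝ E := NormedSpace.ofCore core
  exact ⟨E, inferInstance, inferInstance, LinearEquiv.refl ℝ E, fun x => rfl⟩

/-- The difference body of a convex disc is the closed unit ball of a norm on the plane. -/
theorem IsConvexDisc.exists_norm {C : Set (EuclideanSpace ℝ (Fin 2))} (hC : IsConvexDisc C) :
    ∃ (F : Type) (_ : NormedAddCommGroup F) (_ : NormedSpace ℝ F)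
      (e : EuclideanSpace ℝ (Fin 2) ≃ₗ[ℝ] F),
      (∀ x, x ∈ C - C ↔ ‖e x‖ ≤ 1) ∧ (∀ x, x ∈ interior C - interior C ↔ ‖e x‖ < 1) := by
  have hconv : Convex ℝ (C - C) := hC.convex.sub hC.convex
  have hcomp : IsCompact (C - C) := by
    rw [sub_eq_add_neg]; exact hC.isCompact.add hC.isCompact.neg
  obtain ⟨c, hc⟩ := hC.interior_nonempty
  have hopen : IsOpen (interior C - interior C) := isOpen_interior.sub_right
  have hsub : interior C - interior C ⊆ C - C := Set.sub_subset_sub interior_subset interior_subset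
  have hnhds : C - C ∈ nhds 0 :=
    Filter.mem_of_superset (hopen.mem_nhds ⟨c, hc, c, hc, sub_self c⟩) hsub
  have habs : Absorbent ℝ (C - C) := absorbent_nhds_zero hnhds
  have hbal : Balanced ℝ (C - C) := by
    rw [balanced_iff_neg_mem hconv]
    rintro _ ⟨a, ha, b, hb, rfl⟩
    exact ⟨b, hb, a, ha, by simp⟩
  have hbdd : Bornology.IsVonNBounded ℝ (C - C) :=
    (NormedSpace.isVonNBounded_iff ℝ).2 hcomp.isBounded
  obtain ⟨F, i1, i2, e, he⟩ := exists_normedSpace_of_norm (gauge (C - C)) gauge_nonneg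
    (gauge_smul hbal) (gauge_add_le hconv habs) (fun x => gauge_eq_zero habs hbdd)
  refine ⟨F, i1, i2, e, fun x => ?_, fun x => ?_⟩
  · rw [he, gauge_le_one_iff_mem_closure hconv hnhds, hcomp.isClosed.closure_eq]
  · rw [he]
    constructor
    · intro hx
      exact interior_subset_gauge_lt_one _ (interior_maximal hsub hopen hx)
    · intro hx
      -- Shrinking `a` and `b` by the factor `r < 1` towards the same interior point `c` puts both
      -- in the interior and leaves the difference `r • (a - b)`.
      obtain ⟨r, h0, h1, _, ⟨a, ha, b, hb, rfl⟩, rfl⟩ := exists_lt_of_gauge_lt habs hx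
      have key : ∀ a ∈ C, r • a + (1 - r) • c ∈ interior C := fun a ha =>
        hC.convex.combo_self_interior_mem_interior ha hc h0.le (by linarith) (by linarith)
      exact ⟨_, key a ha, _, key b hb, by simp [smul_sub]⟩

theorem maximal_pairwise_iff {α : Type*} {P : α → Prop} {r : α → α → Prop} [Std.Symm r]
    {V : Set α} : Maximal (fun V : Set α => (∀ v ∈ V, P v) ∧ V.Pairwise r) V ↔
      ((∀ v ∈ V, P v) ∧ V.Pairwise r) ∧ ∀ z, P z → z ∈ V ∨ ∃ v ∈ V, ¬ r z v := by
  refine and_congr_right fun hV => ⟨fun H z hz => ?_, fun H W hW hVW z hz => ?_⟩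
  · by_contra! hcon
    refine hcon.1 (H (y := insert z V) ⟨?_, ?_⟩ (Set.subset_insert z V) (Set.mem_insert z V))
    · rintro v (rfl | hv)
      exacts [hz, hV.1 v hv]
    · exact hV.2.insert_of_symm fun v hv _ => hcon.2 v hv
  · rcases H z (hW.1 z hz) with h | ⟨v, hv, hzv⟩
    · exact h
    · by_contra hzV
      exact hzv (hW.2 hz (hVW hv) (by rintro rfl; exact hzV hv))

theorem mem_vadd_parallelepiped_iff {E : Type*} [AddCommGroup E] [Module ℝ E] {a z : E}
    {w : Fin 2 → E} : z ∈ a +ᵥ parallelepiped w ↔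
      ∃ s t : ℝ, (0 ≤ s ∧ s ≤ 1) ∧ (0 ≤ t ∧ t ≤ 1) ∧ z = a + (s • w 0 + t • w 1) := by
  constructor
  · rintro ⟨y, hy, rfl⟩
    obtain ⟨t, ht, rfl⟩ := (mem_parallelepiped_iff w y).1 hy
    exact ⟨t 0, t 1, ⟨ht.1 0, ht.2 0⟩, ⟨ht.1 1, ht.2 1⟩, by simp [Fin.sum_univ_two]⟩
  · rintro ⟨s, t, hs, ht, rfl⟩
    refine ⟨_, (mem_parallelepiped_iff w _).2 ⟨![s, t], ⟨fun i => ?_, fun i => ?_⟩, rfl⟩, ?_⟩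
    · fin_cases i
      exacts [hs.1, ht.1]
    · fin_cases i
      exacts [hs.2, ht.2]
    · simp [Fin.sum_univ_two]

variable {F : Type} [NormedAddCommGroup F] [NormedSpace ℝ F]
  {C : Set (EuclideanSpace ℝ (Fin 2))} {e : EuclideanSpace ℝ (Fin 2) ≃ₗ[ℝ] F}

theorem IsParallelogram.hasParallelogramBall (hP : IsParallelogram C)
    (he : ∀ x, x ∈ C - C ↔ ‖e x‖ ≤ 1) : HasParallelogramBall F := by
  obtain ⟨a, w, hli, rfl⟩ := hP
  have hli' : LinearIndependent ℝ ![w 0, w 1] := by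
    convert hli using 1
    ext i; fin_cases i <;> rfl
  have hpair := LinearIndependent.pair_iff.1 hli'
  refine ⟨e (w 0), e (w 1), ?_, fun α β => ?_⟩
  · rw [LinearIndependent.pair_iff]
    intro s t hst
    refine hpair s t (e.injective ?_)
    rw [map_add, map_smul, map_smul, hst, map_zero]
  · rw [← map_smul, ← map_smul, ← map_add, ← he]
    constructor
    · rintro ⟨x, hx, y, hy, hxy⟩
      obtain ⟨s, t, hs, ht, rfl⟩ := mem_vadd_parallelepiped_iff.1 hx
      obtain ⟨s', t', hs', ht', rfl⟩ := mem_vadd_parallelepiped_iff.1 hy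
      have h0 : (s - s' - α) • w 0 + (t - t' - β) • w 1 = 0 := by
        have hxy : a + (s • w 0 + t • w 1) - (a + (s' • w 0 + t' • w 1)) = α • w 0 + β • w 1 := hxy
        rw [← sub_eq_zero] at hxy
        rw [← hxy]; module
      obtain ⟨h1, h2⟩ := hpair _ _ h0
      rw [abs_le, abs_le]
      exact ⟨⟨by linarith, by linarith⟩, ⟨by linarith, by linarith⟩⟩
    · rintro ⟨hα, hβ⟩
      rw [abs_le] at hα hβ
      have mem : ∀ s t : ℝ, (0 ≤ s ∧ s ≤ 1) → (0 ≤ t ∧ t ≤ 1) →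
          a + (s • w 0 + t • w 1) ∈ a +ᵥ parallelepiped w := fun s t hs ht =>
        mem_vadd_parallelepiped_iff.2 ⟨s, t, hs, ht, rfl⟩
      -- Each coordinate is written as its positive part minus its negative part.
      refine ⟨_, mem (max α 0) (max β 0) ⟨le_max_right _ _, max_le hα.2 zero_le_one⟩
        ⟨le_max_right _ _, max_le hβ.2 zero_le_one⟩, _, mem (max (-α) 0) (max (-β) 0)
        ⟨le_max_right _ _, max_le (by linarith) zero_le_one⟩
        ⟨le_max_right _ _, max_le (by linarith) zero_le_one⟩, ?_⟩
      have e1 : max α 0 - max (-α) 0 = α := max_zero_sub_max_neg_zero_eq_self α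
      have e2 : max β 0 - max (-β) 0 = β := max_zero_sub_max_neg_zero_eq_self β
      change _ - _ = _
      nth_rw 3 [← e1, ← e2]
      module

/-- The corner `u + w` of the difference body is some `c' - c`, which confines `C` to the
parallelogram with opposite vertices `c` and `c'`. The corner `u - w` is some `k' - k`, which forces
`k` and `k'` to be the other two vertices; convexity fills in the rest. -/
theorem HasParallelogramBall.isParallelogram (hF : Module.finrank ℝ F = 2)
    (hP : HasParallelogramBall F) (hC : Convex ℝ C)
    (he : ∀ x, x ∈ C - C ↔ ‖e x‖ ≤ 1) : IsParallelogram C := by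
  obtain ⟨u, w, hli, key⟩ := hP
  have mem_sub : ∀ a b : ℝ, a • e.symm u + b • e.symm w ∈ C - C ↔ |a| ≤ 1 ∧ |b| ≤ 1 := fun a b => by
    rw [he, ← key]; simp
  obtain ⟨c', hc', c, hc, hcc⟩ := (mem_sub 1 1).2 (by simp)
  obtain ⟨k', hk', k, hk, hkk⟩ := (mem_sub 1 (-1)).2 (by simp)
  have coord : ∀ z ∈ C, ∃ a b : ℝ, (0 ≤ a ∧ a ≤ 1) ∧ (0 ≤ b ∧ b ≤ 1) ∧
      z = c + (a • e.symm u + b • e.symm w) := fun z hz => by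
    obtain ⟨a, b, hab⟩ := exists_eq_combination hF hli (e (z - c))
    have hzc : z - c = a • e.symm u + b • e.symm w := by
      apply e.injective; rw [hab]; simp
    have h1 := (mem_sub a b).1 ⟨z, hz, c, hc, hzc⟩
    have h2 := (mem_sub (a - 1) (b - 1)).1 ⟨z, hz, c', hc', by
      change z - c' = _
      change c' - c = _ at hcc
      rw [show z - c' = (z - c) - (c' - c) by abel, hcc, hzc]; module⟩
    simp only [abs_le] at h1 h2
    exact ⟨a, b, ⟨by linarith, by linarith⟩, ⟨by linarith, by linarith⟩, by rw [← hzc]; abel⟩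
  have hkV : k' = k + (e.symm u - e.symm w) := by
    change k' - k = _ at hkk
    rw [← sub_add_cancel k' k, hkk]; module
  have hcV : c' = c + (e.symm u + e.symm w) := by
    change c' - c = _ at hcc
    rw [← sub_add_cancel c' c, hcc]; module
  obtain ⟨a, b, ha, hb, hkc⟩ := coord k hk
  obtain ⟨a', b', ha', hb', hkc'⟩ := coord k' hk'
  have hpair := LinearIndependent.pair_iff.1 hli (a + 1 - a') (b - 1 - b') (by
    have : (a + 1 - a') • e.symm u + (b - 1 - b') • e.symm w = 0 := by
      rw [hkV, hkc, ← sub_eq_zero] at hkc'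
      rw [← hkc']; module
    simpa using congrArg e this)
  have ha0 : a = 0 := by linarith
  have hb1 : b = 1 := by linarith
  have hk2 : k = c + e.symm w := by rw [hkc, ha0, hb1]; module
  have hk1 : k' = c + e.symm u := by rw [hkV, hk2]; abel
  refine ⟨c, ![e.symm u, e.symm w], ?_, ?_⟩
  · rw [LinearIndependent.pair_iff]
    intro s t hst
    exact LinearIndependent.pair_iff.1 hli s t (by simpa using congrArg e hst)
  · ext z
    rw [mem_vadd_parallelepiped_iff]
    constructor
    · exact coord z
    · rintro ⟨s, t, hs, ht, rfl⟩
      have h1 := hC hc hk' (sub_nonneg.2 hs.2) hs.1 (by ring)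
      have h2 := hC hk hc' (sub_nonneg.2 hs.2) hs.1 (by ring)
      have h3 := hC h1 h2 (sub_nonneg.2 ht.2) ht.1 (by ring)
      convert h3 using 1
      rw [hk1, hk2, hcV]
      simp only [Matrix.cons_val_zero, Matrix.cons_val_one]
      module

end Transfer

/-! ### Maximal families as covers of the unit circle, and the blocking numbers. -/

section Families

variable {F : Type} [NormedAddCommGroup F] [NormedSpace ℝ F]
  {C : Set (EuclideanSpace ℝ (Fin 2))} {e : EuclideanSpace ℝ (Fin 2) ≃ₗ[ℝ] F}

theorem overlap_iff_norm_lt_one (hlt : ∀ x, x ∈ interior C - interior C ↔ ‖e x‖ < 1)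
    (x y : EuclideanSpace ℝ (Fin 2)) : Overlap (x +ᵥ C) (y +ᵥ C) ↔ ‖e x - e y‖ < 1 := by
  rw [overlap_vadd_iff, hlt, map_sub]

theorem overlap_self_iff_norm_lt_one (hlt : ∀ x, x ∈ interior C - interior C ↔ ‖e x‖ < 1)
    (x : EuclideanSpace ℝ (Fin 2)) : Overlap (x +ᵥ C) C ↔ ‖e x‖ < 1 := by
  simpa using overlap_iff_norm_lt_one hlt x 0

theorem disjoint_iff_one_lt_norm (hle : ∀ x, x ∈ C - C ↔ ‖e x‖ ≤ 1)
    (x y : EuclideanSpace ℝ (Fin 2)) : Disjoint (x +ᵥ C) (y +ᵥ C) ↔ 1 < ‖e x - e y‖ := by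
  rw [← not_iff_not, Set.not_disjoint_iff_nonempty_inter, vadd_inter_vadd_nonempty, hle, map_sub,
    not_lt]

theorem touch_iff_norm_eq_one (hle : ∀ x, x ∈ C - C ↔ ‖e x‖ ≤ 1)
    (hlt : ∀ x, x ∈ interior C - interior C ↔ ‖e x‖ < 1) (x : EuclideanSpace ℝ (Fin 2)) :
    Touch (x +ᵥ C) C ↔ ‖e x‖ = 1 := by
  have h := vadd_inter_vadd_nonempty (A := C) (B := C) (x := x) (y := 0)
  rw [zero_vadd, sub_zero, hle] at h
  rw [Touch, h, overlap_self_iff_norm_lt_one hlt, not_lt, ← le_antisymm_iff]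

theorem maximal_isHadwigerFamily_iff (hle : ∀ x, x ∈ C - C ↔ ‖e x‖ ≤ 1)
    (hlt : ∀ x, x ∈ interior C - interior C ↔ ‖e x‖ < 1) {V : Set (EuclideanSpace ℝ (Fin 2))} :
    Maximal (IsHadwigerFamily C) V ↔
      ((∀ v ∈ V, ‖e v‖ = 1) ∧ V.Pairwise fun v w => 1 ≤ ‖e v - e w‖) ∧
        ∀ z, ‖e z‖ = 1 → z ∈ V ∨ ∃ v ∈ V, ‖e z - e v‖ < 1 := by
  have : IsHadwigerFamily C = fun V : Set (EuclideanSpace ℝ (Fin 2)) =>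
      (∀ v ∈ V, ‖e v‖ = 1) ∧ V.Pairwise fun v w => 1 ≤ ‖e v - e w‖ := by
    ext V
    simp only [IsHadwigerFamily, touch_iff_norm_eq_one hle hlt, overlap_iff_norm_lt_one hlt, not_lt]
  have : Std.Symm fun v w : EuclideanSpace ℝ (Fin 2) => 1 ≤ ‖e v - e w‖ :=
    ⟨fun v w h => by rwa [norm_sub_rev]⟩
  simp only [*, maximal_pairwise_iff, not_le]

theorem maximal_isStrictHadwigerFamily_iff (hle : ∀ x, x ∈ C - C ↔ ‖e x‖ ≤ 1)
    (hlt : ∀ x, x ∈ interior C - interior C ↔ ‖e x‖ < 1) {V : Set (EuclideanSpace ℝ (Fin 2))} :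
    Maximal (IsStrictHadwigerFamily C) V ↔
      ((∀ v ∈ V, ‖e v‖ = 1) ∧ V.Pairwise fun v w => 1 < ‖e v - e w‖) ∧
        ∀ z, ‖e z‖ = 1 → z ∈ V ∨ ∃ v ∈ V, ‖e z - e v‖ ≤ 1 := by
  have : IsStrictHadwigerFamily C = fun V : Set (EuclideanSpace ℝ (Fin 2)) =>
      (∀ v ∈ V, ‖e v‖ = 1) ∧ V.Pairwise fun v w => 1 < ‖e v - e w‖ := by
    ext V
    simp only [IsStrictHadwigerFamily, touch_iff_norm_eq_one hle hlt, disjoint_iff_one_lt_norm hle]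
  have : Std.Symm fun v w : EuclideanSpace ℝ (Fin 2) => 1 < ‖e v - e w‖ :=
    ⟨fun v w h => by rwa [norm_sub_rev]⟩
  simp only [*, maximal_pairwise_iff, not_lt]

theorem maximal_isHadwigerFamily_image (hle : ∀ x, x ∈ C - C ↔ ‖e x‖ ≤ 1)
    (hlt : ∀ x, x ∈ interior C - interior C ↔ ‖e x‖ < 1) {W : Set F}
    (h1 : ∀ v ∈ W, ‖v‖ = 1) (hW : W.Pairwise fun v w => 1 ≤ ‖v - w‖)
    (hcov : ∀ z, ‖z‖ = 1 → ∃ v ∈ W, ‖z - v‖ < 1) :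
    Maximal (IsHadwigerFamily C) (e ⁻¹' W) := by
  rw [maximal_isHadwigerFamily_iff hle hlt]
  refine ⟨⟨fun v hv => h1 _ hv, fun v hv w hw hvw => hW hv hw (e.injective.ne hvw)⟩,
    fun z hz => Or.inr ?_⟩
  obtain ⟨v, hv, hzv⟩ := hcov _ hz
  exact ⟨e.symm v, by simpa using hv, by simpa using hzv⟩

theorem maximal_isStrictHadwigerFamily_image (hle : ∀ x, x ∈ C - C ↔ ‖e x‖ ≤ 1)
    (hlt : ∀ x, x ∈ interior C - interior C ↔ ‖e x‖ < 1) {W : Set F}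
    (h1 : ∀ v ∈ W, ‖v‖ = 1) (hW : W.Pairwise fun v w => 1 < ‖v - w‖)
    (hcov : ∀ z, ‖z‖ = 1 → ∃ v ∈ W, ‖z - v‖ ≤ 1) :
    Maximal (IsStrictHadwigerFamily C) (e ⁻¹' W) := by
  rw [maximal_isStrictHadwigerFamily_iff hle hlt]
  refine ⟨⟨fun v hv => h1 _ hv, fun v hv w hw hvw => hW hv hw (e.injective.ne hvw)⟩,
    fun z hz => Or.inr ?_⟩
  obtain ⟨v, hv, hzv⟩ := hcov _ hz
  exact ⟨e.symm v, by simpa using hv, by simpa using hzv⟩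

theorem encard_preimage_linearEquiv (e : EuclideanSpace ℝ (Fin 2) ≃ₗ[ℝ] F) (W : Set F) :
    (e ⁻¹' W).encard = W.encard :=
  Set.encard_preimage_of_bijective e.bijective W

theorem encard_pair_le {α : Type*} (a b : α) : ({a, b} : Set α).encard ≤ 2 := by
  refine (Set.encard_insert_le _ _).trans ?_
  rw [Set.encard_singleton, one_add_one_eq_two]

theorem blockingNumber_eq_four (hF : Module.finrank ℝ F = 2)
    (hle : ∀ x, x ∈ C - C ↔ ‖e x‖ ≤ 1)
    (hlt : ∀ x, x ∈ interior C - interior C ↔ ‖e x‖ < 1) : blockingNumber C = 4 := by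
  refine le_antisymm ?_ ?_
  · obtain ⟨p, x, hp, hx, h1, h2, hcov⟩ := exists_cover_four hF
    have h1' : 1 ≤ ‖p - x‖ := by rwa [norm_sub_rev]
    have h2' : 1 ≤ ‖p + x‖ := by rwa [add_comm]
    have two : ∀ {p : F}, ‖p‖ = 1 → 1 ≤ ‖p + p‖ := fun {p} hp => by
      rw [← two_smul ℝ, norm_smul, hp]; norm_num
    have hp2 := two hp
    have hx2 := two hx
    have e1 : ∀ a b : F, ‖-a - b‖ = ‖a + b‖ := fun a b => by
      rw [← norm_neg, neg_sub, sub_neg_eq_add, add_comm]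
    have e2 : ∀ a b : F, ‖-a + b‖ = ‖a - b‖ := fun a b => by
      rw [← norm_neg, neg_add, neg_neg, sub_eq_add_neg]
    have hmax := maximal_isHadwigerFamily_image (W := {p, -p, x, -x}) hle hlt
      (by simp [hp, hx])
      (by
        rintro a (rfl | rfl | rfl | rfl) b (rfl | rfl | rfl | rfl) hab <;>
        first
          | exact absurd rfl hab
          | simpa only [sub_neg_eq_add, e1, e2])
      (fun z hz => by simpa [sub_neg_eq_add] using hcov z hz)
    refine (sInf_le ⟨_, hmax, rfl⟩ : blockingNumber C ≤ (e ⁻¹' {p, -p, x, -x}).encard).trans ?_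
    rw [encard_preimage_linearEquiv]
    refine (Set.encard_insert_le _ _).trans ?_
    refine (add_le_add_left (Set.encard_insert_le _ _) 1).trans ?_
    refine (add_le_add_left (add_le_add_left (encard_pair_le _ _) 1) 1).trans ?_
    norm_num
  · refine le_sInf ?_
    rintro _ ⟨V, hV, rfl⟩
    obtain ⟨⟨h1, -⟩, hcov⟩ := (maximal_isHadwigerFamily_iff hle hlt).1 hV
    rcases V.finite_or_infinite with hfin | hinf
    · have := hfin.fintype
      rw [← Set.coe_fintypeCard]
      have := four_le_card_of_cover hF (fun v : V => e v) (fun v => (h1 v v.2).ge) fun x hx => by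
        rcases hcov (e.symm x) (by simpa using hx) with h | ⟨v, hv, h⟩
        · exact ⟨⟨_, h⟩, by simp⟩
        · exact ⟨⟨v, hv⟩, by simpa using h⟩
      exact_mod_cast this
    · rw [hinf.encard_eq]; exact le_top

theorem strictBlockingNumber_eq_three (hF : Module.finrank ℝ F = 2)
    (hle : ∀ x, x ∈ C - C ↔ ‖e x‖ ≤ 1)
    (hlt : ∀ x, x ∈ interior C - interior C ↔ ‖e x‖ < 1) (hP : ¬ HasParallelogramBall F) :
    strictBlockingNumber C = 3 := by
  refine le_antisymm ?_ ?_
  · obtain ⟨a, b, c, ha, hb, hc, hab, hac, hbc, hcov⟩ := exists_strict_cover_three hF hP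
    have hmax := maximal_isStrictHadwigerFamily_image (W := {a, b, c}) hle hlt
      (by simp [ha, hb, hc])
      (by
        rintro x (rfl | rfl | rfl) y (rfl | rfl | rfl) hxy <;>
        first
          | exact absurd rfl hxy
          | assumption
          | (rw [norm_sub_rev]; assumption))
      (fun z hz => by simpa using hcov z hz)
    refine (sInf_le ⟨_, hmax, rfl⟩ : strictBlockingNumber C ≤ (e ⁻¹' {a, b, c}).encard).trans ?_
    rw [encard_preimage_linearEquiv]
    refine (Set.encard_insert_le _ _).trans ?_
    refine (add_le_add_left (encard_pair_le _ _) 1).trans ?_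
    norm_num
  · refine le_sInf ?_
    rintro _ ⟨V, hV, rfl⟩
    obtain ⟨⟨h1, -⟩, hcov⟩ := (maximal_isStrictHadwigerFamily_iff hle hlt).1 hV
    have hcov' : ∀ x : F, ‖x‖ = 1 → ∃ v ∈ V, ‖x - e v‖ ≤ 1 := fun x hx => by
      rcases hcov (e.symm x) (by simpa using hx) with h | ⟨v, hv, h⟩
      · exact ⟨_, h, by simp⟩
      · exact ⟨v, hv, by simpa using h⟩
    by_contra! hcard
    have hcard : V.encard ≤ 2 := ENat.lt_natCast_add_one_iff.1 (by exact_mod_cast hcard)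
    obtain ⟨p, hp⟩ := exists_norm_one hF
    obtain ⟨u, hu, -⟩ := hcov' p hp
    -- A one-element family is treated as a pair with `w = u`.
    have : ∃ w ∈ V, V ⊆ {u, w} := by
      by_cases h : ∃ w ∈ V, w ≠ u
      · obtain ⟨w, hw, hwu⟩ := h
        refine ⟨w, hw, (Set.Finite.eq_of_subset_of_encard_le (Set.toFinite _)
          (Set.pair_subset hu hw) ?_).ge⟩
        rwa [Set.encard_pair hwu.symm]
      · push Not at h
        exact ⟨u, hu, fun v hv => Or.inl (h v hv)⟩
    obtain ⟨w, hw, hVw⟩ := this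
    refine hP (hasParallelogramBall_of_cover_two hF (h1 u hu) (h1 w hw) fun x hx => ?_)
    obtain ⟨v, hv, h⟩ := hcov' x hx
    rcases hVw hv with rfl | rfl
    exacts [Or.inl h, Or.inr h]

theorem strictBlockingNumber_eq_two (hF : Module.finrank ℝ F = 2)
    (hle : ∀ x, x ∈ C - C ↔ ‖e x‖ ≤ 1)
    (hlt : ∀ x, x ∈ interior C - interior C ↔ ‖e x‖ < 1) (hP : HasParallelogramBall F) :
    strictBlockingNumber C = 2 := by
  have two : ∀ {p : F}, ‖p‖ = 1 → 1 < ‖p - -p‖ := fun {p} hp => by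
    rw [sub_neg_eq_add, ← two_smul ℝ, norm_smul, hp]; norm_num
  refine le_antisymm ?_ ?_
  · obtain ⟨u, hu, hcov⟩ := hP.exists_strict_cover_two hF
    have hmax := maximal_isStrictHadwigerFamily_image (W := {u, -u}) hle hlt
      (by simp [hu])
      (by
        rintro x (rfl | rfl) y (rfl | rfl) hxy
        · exact absurd rfl hxy
        · exact two hu
        · rw [norm_sub_rev]; exact two hu
        · exact absurd rfl hxy)
      (fun z hz => by simpa using hcov z hz)
    refine (sInf_le ⟨_, hmax, rfl⟩ : strictBlockingNumber C ≤ (e ⁻¹' {u, -u}).encard).trans ?_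
    rw [encard_preimage_linearEquiv]
    exact encard_pair_le _ _
  · refine le_sInf ?_
    rintro _ ⟨V, hV, rfl⟩
    obtain ⟨⟨h1, -⟩, hcov⟩ := (maximal_isStrictHadwigerFamily_iff hle hlt).1 hV
    have hcov' : ∀ x : F, ‖x‖ = 1 → ∃ v ∈ V, ‖x - e v‖ ≤ 1 := fun x hx => by
      rcases hcov (e.symm x) (by simpa using hx) with h | ⟨v, hv, h⟩
      · exact ⟨_, h, by simp⟩
      · exact ⟨v, hv, by simpa using h⟩
    obtain ⟨p, hp⟩ := exists_norm_one hF
    obtain ⟨u, hu, -⟩ := hcov' p hp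
    -- The antipode of `e u` is at distance 2 from it, so a second vector is needed to cover it.
    obtain ⟨v, hv, h⟩ := hcov' (-e u) (by simpa using h1 u hu)
    have huv : u ≠ v := by
      rintro rfl
      rw [norm_sub_rev] at h
      exact absurd (two (h1 u hu)) (not_lt.2 h)
    rw [← Set.encard_pair huv]
    exact Set.encard_le_encard (Set.pair_subset hu hv)

end Families

theorem mainTheorem7 (C : Set (EuclideanSpace ℝ (Fin 2))) (hC : IsConvexDisc C) :
    blockingNumber C = 4 ∧
    (¬ IsParallelogram C → strictBlockingNumber C = 3) ∧
    (IsParallelogram C → strictBlockingNumber C = 2) ∧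
    (∀ (m : ℕ) (v : Fin m → EuclideanSpace ℝ (Fin 2)),
      (∀ i, ¬ Overlap (v i +ᵥ C) C) →
      (∀ x : EuclideanSpace ℝ (Fin 2), Touch (x +ᵥ C) C →
        ∃ i, Overlap (x +ᵥ C) (v i +ᵥ C)) →
      4 ≤ m) := by
  obtain ⟨F, _, _, e, hle, hlt⟩ := hC.exists_norm
  have hF : Module.finrank ℝ F = 2 := by rw [← e.finrank_eq]; simp
  refine ⟨blockingNumber_eq_four hF hle hlt,
    fun h => strictBlockingNumber_eq_three hF hle hlt fun hP =>
      h (hP.isParallelogram hF hC.convex hle),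
    fun h => strictBlockingNumber_eq_two hF hle hlt (h.hasParallelogramBall hle),
    fun m v hv hcov => ?_⟩
  rw [← Fintype.card_fin m]
  refine four_le_card_of_cover hF (fun i => e (v i)) (fun i => ?_) fun x hx => ?_
  · rw [← not_lt, ← overlap_self_iff_norm_lt_one hlt]
    exact hv i
  · obtain ⟨i, hi⟩ := hcov (e.symm x) ((touch_iff_norm_eq_one hle hlt _).2 (by simpa using hx))
    exact ⟨i, by simpa using (overlap_iff_norm_lt_one hlt _ _).1 hi⟩
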